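/- Let $n\ge 2$ be an integer and $c\ge 1$ a real number. Equip $\mathbb{R}^{2n}$ with coordinates $(q^1,p_1,\dots,q^n,p_n)$ and the standard symplectic form $\omega_0=\sum_{i=1}^n dq^i\wedge dp_i$. For $z\in\mathbb{R}^{2n-2}$ let $\iota_z:\mathbb{R}^2\to\mathbb{R}^{2n}$, $\iota_z(y):=(y,z)$. A symplectic embedding is a smooth embedding that pulls $\omega_0$ back to $\omega_0$, and area means two-dimensional Lebesgue measure. Then there exists a symplectic embedding $\varphi:(0,1)^{2n}\to(0,1)^{2n-1}\times(0,c)$ such that for every $z\in\mathbb{R}^{2n-2}$: 1. the section $\iota_z^{-1}\big(\varphi((0,1)^{2n})\big)\subseteq\mathbb{R}^2$ has area at most $\frac1c$; 2. the complement of this section in $\mathbb{R}^2$ is path-connected. The bound $\frac1c$ is sharp: for every symplectic embedding $\varphi:(0,1)^{2n}\to(0,1)^{2n-1}\times(0,c)$ there exists $z\in\mathbb{R}^{2n-2}$ such that the section $\iota_z^{-1}\big(\varphi((0,1)^{2n})\big)$ has area at least $\frac1c$. -/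

import Mathlib

open scoped ContDiff

/-- `ℝ^{2n}` with its standard coordinates `q¹, p₁, …, qⁿ, pₙ`: the `i`-th entry of a point is the
pair `(qⁱ, pᵢ)`. (The indices run from `0` to `n - 1`.) -/
abbrev PhaseSpace (n : ℕ) : Type := Fin n → ℝ × ℝ

/-- The standard symplectic form `ω₀ = ∑ᵢ dqⁱ ∧ dpᵢ`. -/
def omega0 {n : ℕ} (u v : PhaseSpace n) : ℝ :=
  ∑ i, ((u i).1 * (v i).2 - (u i).2 * (v i).1)

/-- `φ`, restricted to the open set `U ⊆ ℝ^{2n}`, is a symplectic embedding: it is smooth, a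
homeomorphism onto its image, and `φ^* ω₀ = ω₀` at all points of `U`. (It is then automatically an
immersion, since `ω₀` is nondegenerate.) The values of `φ` outside `U` are irrelevant. -/
structure IsSymplecticEmbeddingOn {n : ℕ} (φ : PhaseSpace n → PhaseSpace n)
    (U : Set (PhaseSpace n)) : Prop where
  contDiffOn : ContDiffOn ℝ ∞ φ U
  isEmbedding : Topology.IsEmbedding (U.domRestrict φ)
  pullback_eq : ∀ x ∈ U, ∀ u v : PhaseSpace n,
    omega0 (fderiv ℝ φ x u) (fderiv ℝ φ x v) = omega0 u v

/-- The open polydisc `(0,1)^{2n-1} × (0,c)`: all coordinates lie in `(0,1)`, except that the last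
one, `pₙ`, lies in `(0,c)`. -/
def polydisc (n : ℕ) (c : ℝ) : Set (PhaseSpace n) :=
  {x | ∀ i : Fin n, (x i).1 ∈ Set.Ioo (0 : ℝ) 1 ∧
    (x i).2 ∈ Set.Ioo (0 : ℝ) (if i.val + 1 = n then c else 1)}

/-- The open cube `(0,1)^{2n}`. -/
def cube (n : ℕ) : Set (PhaseSpace n) :=
  {x | ∀ i : Fin n, (x i).1 ∈ Set.Ioo (0 : ℝ) 1 ∧ (x i).2 ∈ Set.Ioo (0 : ℝ) 1}

/-- The map `ι_z : ℝ² → ℝ^{2n}`, `ι_z(y) = (y, z)`, for `z ∈ ℝ^{2n-2}`. -/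
def iota {n : ℕ} (z : PhaseSpace (n - 1)) (y : ℝ × ℝ) : PhaseSpace n :=
  fun i => if h : i.val = 0 then y else z ⟨i.val - 1, by have := i.isLt; omega⟩

/-! Existence: shear the cube by `p₀ ↦ p₀ + c·q_last`, `p_last ↦ p_last + c·q₀`, then read `p₀`
modulo 1 and `p_last` modulo `c`. Since `c ≥ 1`, the cube still injects into the product of the
annuli `(0,1) × ℝ/ℤ` and `(0,1) × ℝ/cℤ` with the untouched middle factors. Area-preserving maps
(polar coordinates, then disc to square) put the annuli into rectangles; the result is
`windingEmbedding`. Fixing `z` fixes `q_last` and the class `s` of `p_last + c·q₀` modulo `c`. So `s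
- c·q₀` must lie in `(0,1)` modulo `c`, while `p₀` stays free (`section_windingEmbedding`). As `q₀`
crosses `(0,1)`, `c·q₀` winds once around `ℝ/cℤ`, so the admissible `q₀` have measure at most `1/c`
(`volume_windingPositions_le`). The section is a union of concentric annuli slit along one common
ray; the ray joins all the gaps to the outside (`isPathConnected_compl_image_annulusToSquare`).
Sharpness: the image has volume 1 and projects into a polydisc of volume `c`, so by Fubini some
section has area at least `1/c` (`exists_section_volume_ge`). -/

open MeasureTheory Topology

/-! ### Linear algebra of invariant bilinear forms -/

/-- A linear map preserving a nondegenerate bilinear form has determinant `±1`. -/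
theorem abs_det_eq_one_of_preserves {V : Type*} [AddCommGroup V] [Module ℝ V]
    [FiniteDimensional ℝ V] (B : LinearMap.BilinForm ℝ V) (hB : B.Nondegenerate)
    (L : V →ₗ[ℝ] V) (h : ∀ u v, B (L u) (L v) = B u v) : |LinearMap.det L| = 1 := by
  let b := Module.finBasis ℝ V
  have hcomp : B.comp L L = B := by
    ext u v
    exact h u v
  have hdet := (LinearMap.BilinForm.nondegenerate_iff_det_ne_zero b).1 hB
  -- In matrices `LᵀBL = B`, so `(det L)² det B = det B`. The sign is left open: change of variables
  -- only sees `|det L|`.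
  have key := congrArg Matrix.det (LinearMap.BilinForm.toMatrix_comp b b B L L)
  rw [hcomp, Matrix.det_mul, Matrix.det_mul, Matrix.det_transpose, LinearMap.det_toMatrix] at key
  have h1 : LinearMap.det L ^ 2 = 1 := by
    apply mul_right_cancel₀ hdet
    linarith
  rcases sq_eq_one_iff.1 h1 with h2 | h2 <;> simp [h2]

/-- The standard area form on the plane. -/
def areaForm (u v : ℝ × ℝ) : ℝ := u.1 * v.2 - u.2 * v.1

theorem omega0_eq_sum_areaForm {n : ℕ} (u v : PhaseSpace n) :
    omega0 u v = ∑ i, areaForm (u i) (v i) := rfl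

/-- The standard area form as a bilinear form. -/
def areaBilin : LinearMap.BilinForm ℝ (ℝ × ℝ) :=
  LinearMap.mk₂ ℝ areaForm
    (fun _ _ _ => by simp only [areaForm, Prod.fst_add, Prod.snd_add]; ring)
    (fun _ _ _ => by simp only [areaForm, Prod.smul_fst, Prod.smul_snd, smul_eq_mul]; ring)
    (fun _ _ _ => by simp only [areaForm, Prod.fst_add, Prod.snd_add]; ring)
    (fun _ _ _ => by simp only [areaForm, Prod.smul_fst, Prod.smul_snd, smul_eq_mul]; ring)

theorem areaBilin_nondegenerate : areaBilin.Nondegenerate := by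
  apply LinearMap.BilinForm.Nondegenerate.ofSeparatingLeft
  intro u hu
  have h1 : areaForm u (1, 0) = 0 := hu (1, 0)
  have h2 : areaForm u (0, 1) = 0 := hu (0, 1)
  simp only [areaForm, mul_zero, mul_one, zero_sub, sub_zero, neg_eq_zero] at h1 h2
  exact Prod.ext h2 h1

/-- The standard symplectic form as a bilinear form. -/
def omegaBilin (n : ℕ) : LinearMap.BilinForm ℝ (PhaseSpace n) :=
  ∑ i, areaBilin.comp (LinearMap.proj i) (LinearMap.proj i)

theorem omegaBilin_apply {n : ℕ} (u v : PhaseSpace n) : omegaBilin n u v = omega0 u v := by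
  simp [omegaBilin, omega0_eq_sum_areaForm, LinearMap.sum_apply, areaBilin]

theorem omegaBilin_nondegenerate (n : ℕ) : (omegaBilin n).Nondegenerate := by
  apply LinearMap.BilinForm.Nondegenerate.ofSeparatingLeft
  intro u hu
  funext i
  apply areaBilin_nondegenerate.1
  intro w
  have h := hu (Pi.single i w)
  rw [omegaBilin_apply, omega0_eq_sum_areaForm, Finset.sum_eq_single i] at h
  · simpa [areaBilin] using h
  · intro j _ hj
    simp [hj, areaForm]
  · simp

theorem abs_det_eq_one_of_areaForm (L : (ℝ × ℝ) →L[ℝ] (ℝ × ℝ))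
    (h : ∀ u v, areaForm (L u) (L v) = areaForm u v) : |L.det| = 1 :=
  abs_det_eq_one_of_preserves areaBilin areaBilin_nondegenerate L h

theorem abs_det_eq_one_of_omega0 {n : ℕ} (L : PhaseSpace n →L[ℝ] PhaseSpace n)
    (h : ∀ u v, omega0 (L u) (L v) = omega0 u v) : |L.det| = 1 :=
  abs_det_eq_one_of_preserves (omegaBilin n) (omegaBilin_nondegenerate n) L
    (fun u v => (omegaBilin_apply _ _).trans ((h u v).trans (omegaBilin_apply u v).symm))

/-! ### Embeddings and volume -/

/-- An injective smooth map that preserves `ω₀` on an open set is a symplectic embedding. -/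
theorem isSymplecticEmbeddingOn_of_injOn {n : ℕ} {φ : PhaseSpace n → PhaseSpace n}
    {U : Set (PhaseSpace n)} (hU : IsOpen U) (hφ : ContDiffOn ℝ ∞ φ U) (hinj : Set.InjOn φ U)
    (hω : ∀ x ∈ U, ∀ u v : PhaseSpace n,
      omega0 (fderiv ℝ φ x u) (fderiv ℝ φ x v) = omega0 u v) :
    IsSymplecticEmbeddingOn φ U := by
  refine ⟨hφ, ?_, hω⟩
  -- An invertible strict derivative makes `φ` locally open, so continuity and injectivity already
  -- give a topological embedding.
  refine (IsOpenEmbedding.of_continuous_injective_isOpenMap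
    hφ.continuousOn.domRestrict hinj.injective ?_).isEmbedding
  rw [isOpenMap_iff_nhds_le]
  rintro ⟨x, hx⟩
  have hstrict : HasStrictFDerivAt φ (fderiv ℝ φ x) x :=
    (hφ.contDiffAt (hU.mem_nhds hx)).hasStrictFDerivAt (by simp)
  have hdet := abs_det_eq_one_of_omega0 _ (hω x hx)
  have hrange : (fderiv ℝ φ x : PhaseSpace n →ₗ[ℝ] PhaseSpace n).range = ⊤ := by
    rw [← LinearMap.isUnit_iff_range_eq_top, LinearMap.isUnit_iff_isUnit_det, isUnit_iff_ne_zero]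
    intro h0
    rw [ContinuousLinearMap.det, h0] at hdet
    simp at hdet
  have h1 := hstrict.map_nhds_eq_of_surj hrange
  change 𝓝 (φ x) ≤ Filter.map (φ ∘ Subtype.val) (𝓝 (⟨x, hx⟩ : U))
  rw [← Filter.map_map, map_nhds_subtype_coe_eq_nhds hx (hU.mem_nhds hx), h1]

theorem isOpen_cube (n : ℕ) : IsOpen (cube n) := by
  have : cube n = ⋂ i : Fin n, {x | (x i).1 ∈ Set.Ioo (0 : ℝ) 1 ∧ (x i).2 ∈ Set.Ioo (0 : ℝ) 1} := by
    ext x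
    simp [cube]
  rw [this]
  refine isOpen_iInter_of_finite fun i => IsOpen.inter ?_ ?_
  · exact isOpen_Ioo.preimage (by fun_prop)
  · exact isOpen_Ioo.preimage (by fun_prop)

theorem volume_image_of_symplectic {n : ℕ} {φ : PhaseSpace n → PhaseSpace n}
    {U : Set (PhaseSpace n)} (hU : IsOpen U) (h : IsSymplecticEmbeddingOn φ U) :
    MeasurableSet (φ '' U) ∧ volume (φ '' U) = volume U := by
  have hd : ∀ x ∈ U, HasFDerivWithinAt φ (fderiv ℝ φ x) U x := fun x hx =>
    ((h.contDiffOn.contDiffAt (hU.mem_nhds hx)).differentiableAt (by simp)).hasFDerivAt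
      |>.hasFDerivWithinAt
  have hinj : Set.InjOn φ U := Set.injOn_iff_injective.2 h.isEmbedding.injective
  refine ⟨measurable_image_of_fderivWithin hU.measurableSet hd hinj, ?_⟩
  rw [← lintegral_abs_det_fderiv_eq_addHaar_image volume hU.measurableSet hd hinj]
  rw [setLIntegral_congr_fun hU.measurableSet (g := fun _ => 1)]
  · simp
  · intro x hx
    simp [abs_det_eq_one_of_omega0 _ (h.pullback_eq x hx)]

theorem volume_planar_box (a b : ℝ) :
    volume {y : ℝ × ℝ | y.1 ∈ Set.Ioo (0 : ℝ) a ∧ y.2 ∈ Set.Ioo (0 : ℝ) b} =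
      ENNReal.ofReal a * ENNReal.ofReal b := by
  change volume (Set.Ioo (0 : ℝ) a ×ˢ Set.Ioo (0 : ℝ) b) = _
  rw [Measure.volume_eq_prod, Measure.prod_prod]
  simp

theorem volume_cube (n : ℕ) : volume (cube n) = 1 := by
  have : cube n = Set.univ.pi fun _ : Fin n =>
      {y : ℝ × ℝ | y.1 ∈ Set.Ioo (0 : ℝ) 1 ∧ y.2 ∈ Set.Ioo (0 : ℝ) 1} := by
    ext x
    simp [cube]
  rw [this, volume_pi_pi]
  simp only [volume_planar_box]
  simp

theorem polydisc_eq_pi (n : ℕ) (c : ℝ) : polydisc n c = Set.univ.pi fun i : Fin n =>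
    {y : ℝ × ℝ | y.1 ∈ Set.Ioo (0 : ℝ) 1 ∧
      y.2 ∈ Set.Ioo (0 : ℝ) (if i.val + 1 = n then c else 1)} := by
  ext x
  simp [polydisc]

theorem measurableSet_polydisc (n : ℕ) (c : ℝ) : MeasurableSet (polydisc n c) := by
  rw [polydisc_eq_pi]
  refine MeasurableSet.univ_pi fun i => ?_
  exact measurableSet_Ioo.prod measurableSet_Ioo

theorem volume_polydisc (n : ℕ) (c : ℝ) :
    volume (polydisc (n + 1) c) = ENNReal.ofReal c := by
  rw [polydisc_eq_pi, volume_pi_pi, Finset.prod_eq_single (Fin.last n)]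
  · rw [volume_planar_box]
    simp
  · intro i _ hi
    have : ¬ (i.val + 1 = n + 1) := fun h => hi (Fin.ext (by simpa using h))
    rw [volume_planar_box, if_neg this]
    simp
  · simp

/-! ### The lower bound: Fubini over the sections -/

theorem iota_eq_cons {m : ℕ} (z : PhaseSpace m) (y : ℝ × ℝ) :
    (iota (n := m + 1) z y) = Fin.cons (α := fun _ => ℝ × ℝ) y z := by
  funext i
  refine Fin.cases ?_ (fun j => ?_) i
  · simp [iota]
  · simp [iota]

/-- Fubini's theorem for the sections of a set in `ℝ^{2n}`. -/
theorem lintegral_volume_sections {m : ℕ} {A : Set (PhaseSpace (m + 1))} (hA : MeasurableSet A) :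
    ∫⁻ z : PhaseSpace m, volume (iota (n := m + 1) z ⁻¹' A) = volume A := by
  have hmp := (volume_preserving_piFinSuccAbove (fun _ : Fin (m + 1) => ℝ × ℝ) 0).symm
  rw [← hmp.measure_preimage hA.nullMeasurableSet]
  change _ = ((volume : Measure (ℝ × ℝ)).prod (volume : Measure (PhaseSpace m))) _
  rw [Measure.prod_apply_symm (hmp.measurable hA)]
  refine lintegral_congr fun z => ?_
  congr 1
  ext y
  simp only [Set.mem_preimage, iota_eq_cons]
  change _ ↔ Fin.insertNth (α := fun _ => ℝ × ℝ) 0 y z ∈ A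
  rw [Fin.insertNth_zero']

theorem exists_section_volume_ge {n : ℕ} (hn : 2 ≤ n) {c : ℝ} (hc : 0 < c)
    {φ : PhaseSpace n → PhaseSpace n} (h : IsSymplecticEmbeddingOn φ (cube n))
    (hmaps : Set.MapsTo φ (cube n) (polydisc n c)) :
    ∃ z : PhaseSpace (n - 1), ENNReal.ofReal (1 / c) ≤ volume (iota z ⁻¹' (φ '' cube n)) := by
  -- With `n ≥ 2` the long coordinate of length `c` is among those of `z`, so `z` ranges over a
  -- polydisc of volume `c`.
  obtain ⟨m, rfl⟩ : ∃ m, n = m + 1 + 1 := ⟨n - 2, by omega⟩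
  change ∃ z : PhaseSpace (m + 1), _
  by_contra! hlt
  obtain ⟨hmeas, hvol⟩ := volume_image_of_symplectic (isOpen_cube _) h
  have hint := lintegral_volume_sections hmeas
  rw [hvol, volume_cube] at hint
  have hsupp : Function.support (fun z : PhaseSpace (m + 1) =>
      volume (iota (n := m + 1 + 1) z ⁻¹' (φ '' cube (m + 1 + 1)))) ⊆ polydisc (m + 1) c := by
    intro z hz
    have hne : (iota (n := m + 1 + 1) z ⁻¹' (φ '' cube (m + 1 + 1))).Nonempty := by
      by_contra hempty
      rw [Set.not_nonempty_iff_eq_empty] at hempty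
      exact hz (by simp [hempty])
    obtain ⟨y, x, hx, hxy⟩ := hne
    have hp := hmaps hx
    rw [hxy, iota_eq_cons] at hp
    intro i
    have := hp i.succ
    simpa using this
  rw [← setLIntegral_eq_of_support_subset hsupp] at hint
  have hvolB := volume_polydisc m c
  have hstrict := setLIntegral_strict_mono (μ := volume) (measurableSet_polydisc (m + 1) c)
    (by rw [hvolB]; simpa using hc) (measurable_const (a := ENNReal.ofReal (1 / c)))
    (by rw [hint]; simp) (Filter.Eventually.of_forall fun z _ => hlt z)
  rw [hint, setLIntegral_const, hvolB, ← ENNReal.ofReal_mul (by positivity),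
    one_div_mul_cancel hc.ne'] at hstrict
  simp at hstrict

/-! ### Planar maps scaling the area form -/

/-- The derivative of `f` at `x` multiplies the area form by `k`. -/
def ScalesArea (f : ℝ × ℝ → ℝ × ℝ) (x : ℝ × ℝ) (k : ℝ) : Prop :=
  ∃ L : (ℝ × ℝ) →L[ℝ] (ℝ × ℝ), HasFDerivAt f L x ∧
    ∀ u v, areaForm (L u) (L v) = k * areaForm u v

theorem ScalesArea.comp {f g : ℝ × ℝ → ℝ × ℝ} {x : ℝ × ℝ} {k l : ℝ}
    (hg : ScalesArea g (f x) l) (hf : ScalesArea f x k) : ScalesArea (g ∘ f) x (l * k) := by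
  obtain ⟨L, hL, hLk⟩ := hf
  obtain ⟨M, hM, hMl⟩ := hg
  exact ⟨M.comp L, hM.comp x hL, fun u v => by
    simp only [ContinuousLinearMap.comp_apply, hMl, hLk, mul_assoc]⟩

theorem scalesArea_id (x : ℝ × ℝ) : ScalesArea id x 1 :=
  ⟨ContinuousLinearMap.id ℝ _, hasFDerivAt_id x, fun u v => by simp⟩

theorem scalesArea_mul_snd (c : ℝ) (x : ℝ × ℝ) :
    ScalesArea (fun w => (w.1, c * w.2)) x c := by
  refine ⟨_, hasFDerivAt_fst.prodMk (hasFDerivAt_snd.const_mul c), fun u v => ?_⟩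
  simp [areaForm]
  ring

theorem scalesArea_add_snd (b : ℝ) (x : ℝ × ℝ) :
    ScalesArea (fun w => (w.1, w.2 + b)) x 1 := by
  refine ⟨_, hasFDerivAt_fst.prodMk (hasFDerivAt_snd.add_const b), fun u v => ?_⟩
  simp [areaForm]

/-- Without injectivity the area formula gives only `≤`, which is all the upper bound on sections
needs. -/
theorem ScalesArea.volume_image_le {f : ℝ × ℝ → ℝ × ℝ} {s : Set (ℝ × ℝ)} (hs : MeasurableSet s)
    (hf : ∀ x ∈ s, ScalesArea f x 1) : volume (f '' s) ≤ volume s := by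
  have hd : ∀ x ∈ s, HasFDerivWithinAt f (fderiv ℝ f x) s x := fun x hx => by
    obtain ⟨L, hL, -⟩ := hf x hx
    exact hL.differentiableAt.hasFDerivAt.hasFDerivWithinAt
  refine (addHaar_image_le_lintegral_abs_det_fderiv volume hs hd).trans ?_
  rw [setLIntegral_congr_fun hs (g := fun _ => 1)]
  · simp
  · intro x hx
    obtain ⟨L, hL, hL1⟩ := hf x hx
    have := abs_det_eq_one_of_areaForm L (by simpa using hL1)
    simp [hL.fderiv, this]

/-! ### The area-preserving map from the disc to the square -/

/-- Twice the area of `{(s, y) : 0 ≤ s ≤ x, 0 ≤ y ≤ √(1 - s²)}`. -/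
noncomputable def circleArea (x : ℝ) : ℝ := x * √(1 - x ^ 2) + Real.arcsin x

theorem continuous_circleArea : Continuous circleArea := by
  unfold circleArea
  fun_prop

theorem one_sub_sq_pos {x : ℝ} (hx : x ∈ Set.Ioo (-1 : ℝ) 1) : 0 < 1 - x ^ 2 := by
  nlinarith [hx.1, hx.2]

theorem hasDerivAt_circleArea {x : ℝ} (hx : x ∈ Set.Ioo (-1 : ℝ) 1) :
    HasDerivAt circleArea (2 * √(1 - x ^ 2)) x := by
  have hpos := one_sub_sq_pos hx
  have hs := Real.sqrt_pos.2 hpos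
  have hsq := Real.sq_sqrt hpos.le
  have h1 : HasDerivAt (fun x : ℝ => 1 - x ^ 2) (-(2 * x)) x := by
    simpa using (hasDerivAt_pow 2 x).const_sub 1
  have h2 := (hasDerivAt_id x).mul (h1.sqrt hpos.ne')
  have h3 := h2.add (Real.hasDerivAt_arcsin hx.1.ne' hx.2.ne)
  refine h3.congr_deriv ?_
  simp only [id]
  field_simp
  rw [hsq]
  ring

theorem strictMonoOn_circleArea : StrictMonoOn circleArea (Set.Icc (-1) 1) := by
  refine strictMonoOn_of_deriv_pos (convex_Icc _ _) continuous_circleArea.continuousOn ?_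
  intro x hx
  rw [interior_Icc] at hx
  rw [(hasDerivAt_circleArea hx).deriv]
  exact mul_pos two_pos (Real.sqrt_pos.2 (one_sub_sq_pos hx))

theorem circleArea_one : circleArea 1 = Real.pi / 2 := by simp [circleArea]

theorem circleArea_neg_one : circleArea (-1) = -(Real.pi / 2) := by simp [circleArea]

/-- The area-preserving (up to the factor `1/π`) map from the unit disc onto the unit square that
maps vertical chords to vertical chords. -/
noncomputable def discToSquare (w : ℝ × ℝ) : ℝ × ℝ :=
  (1 / 2 + circleArea w.1 / Real.pi, 1 / 2 + w.2 * (2 * √(1 - w.1 ^ 2))⁻¹)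

theorem contDiffAt_discToSquare {w : ℝ × ℝ} (hw : w.1 ∈ Set.Ioo (-1 : ℝ) 1) :
    ContDiffAt ℝ ∞ discToSquare w := by
  have hpos := one_sub_sq_pos hw
  have hs : ContDiffAt ℝ ∞ (fun w : ℝ × ℝ => √(1 - w.1 ^ 2)) w :=
    ContDiffAt.sqrt (by fun_prop) hpos.ne'
  have ha : ContDiffAt ℝ ∞ (fun w : ℝ × ℝ => Real.arcsin w.1) w :=
    (Real.contDiffAt_arcsin hw.1.ne' hw.2.ne).comp w contDiffAt_fst
  unfold discToSquare circleArea
  refine ContDiffAt.prodMk ?_ ?_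
  · exact contDiffAt_const.add (((contDiffAt_fst.mul hs).add ha).div_const _)
  · refine contDiffAt_const.add (contDiffAt_snd.mul ((contDiffAt_const.mul hs).inv ?_))
    have := Real.sqrt_pos.2 hpos
    positivity

/-- The derivative is triangular with diagonal entries `2√(1 - x²)/π` and `1/(2√(1 - x²))`. -/
theorem scalesArea_discToSquare {w : ℝ × ℝ} (hw : w.1 ∈ Set.Ioo (-1 : ℝ) 1) :
    ScalesArea discToSquare w (1 / Real.pi) := by
  have hpos := one_sub_sq_pos hw
  have hs := Real.sqrt_pos.2 hpos
  have hfst : HasFDerivAt Prod.fst (ContinuousLinearMap.fst ℝ ℝ ℝ) w := hasFDerivAt_fst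
  have hX := (((hasDerivAt_circleArea hw).div_const Real.pi).const_add (1 / 2)).comp_hasFDerivAt w
    hfst
  have hg : DifferentiableAt ℝ (fun x : ℝ => (2 * √(1 - x ^ 2))⁻¹) w.1 := by
    have h0 : (2 * √(1 - w.1 ^ 2)) ≠ 0 := by positivity
    have h1 : DifferentiableAt ℝ (fun x : ℝ => √(1 - x ^ 2)) w.1 :=
      DifferentiableAt.sqrt (by fun_prop) hpos.ne'
    exact (h1.const_mul 2).inv h0
  have hY := ((hasFDerivAt_snd (𝕜 := ℝ) (p := w)).mul
    (hg.hasDerivAt.comp_hasFDerivAt w hfst)).const_add (1 / 2)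
  refine ⟨_, hX.prodMk hY, fun u v => ?_⟩
  simp [areaForm]
  field_simp
  ring

theorem discToSquare_fst_mem {x y : ℝ} (hx : x ∈ Set.Ioo (-1 : ℝ) 1) :
    (discToSquare (x, y)).1 ∈ Set.Ioo (0 : ℝ) 1 := by
  have hx' : x ∈ Set.Icc (-1 : ℝ) 1 := ⟨hx.1.le, hx.2.le⟩
  have h1 := strictMonoOn_circleArea (by norm_num) hx' hx.1
  have h2 := strictMonoOn_circleArea hx' (by norm_num) hx.2
  rw [circleArea_neg_one] at h1
  rw [circleArea_one] at h2
  have h3 : -(1 / 2) < circleArea x / Real.pi := by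
    rw [lt_div_iff₀ Real.pi_pos]; linarith
  have h4 : circleArea x / Real.pi < 1 / 2 := by
    rw [div_lt_iff₀ Real.pi_pos]; linarith
  simp only [discToSquare]
  constructor <;> linarith

/-- The open unit square. -/
def openSquare : Set (ℝ × ℝ) := Set.Ioo (0 : ℝ) 1 ×ˢ Set.Ioo (0 : ℝ) 1

theorem fst_mem_of_mem_disc {x y : ℝ} (h : x ^ 2 + y ^ 2 < 1) : x ∈ Set.Ioo (-1 : ℝ) 1 := by
  constructor <;> nlinarith [sq_nonneg y]

theorem discToSquare_mem {x y : ℝ} (h : x ^ 2 + y ^ 2 < 1) :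
    discToSquare (x, y) ∈ openSquare := by
  have hx := fst_mem_of_mem_disc h
  refine ⟨discToSquare_fst_mem hx, ?_⟩
  have hpos := one_sub_sq_pos hx
  have hs := Real.sqrt_pos.2 hpos
  have hsq := Real.sq_sqrt hpos.le
  have habs : |y| < √(1 - x ^ 2) := by
    rw [← Real.sqrt_sq_eq_abs]
    exact Real.sqrt_lt_sqrt (sq_nonneg y) (by linarith)
  rw [abs_lt] at habs
  simp only [discToSquare, ← div_eq_mul_inv]
  have h3 : -(1 / 2) < y / (2 * √(1 - x ^ 2)) := by
    rw [lt_div_iff₀ (by positivity)]; linarith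
  have h4 : y / (2 * √(1 - x ^ 2)) < 1 / 2 := by
    rw [div_lt_iff₀ (by positivity)]; linarith
  constructor <;> linarith

theorem discToSquare_injOn : Set.InjOn discToSquare {w | w.1 ^ 2 + w.2 ^ 2 < 1} := by
  rintro ⟨x, y⟩ h ⟨x', y'⟩ h' heq
  have hx := fst_mem_of_mem_disc h
  have hx' := fst_mem_of_mem_disc h'
  simp only [discToSquare, Prod.mk.injEq, add_right_inj] at heq
  have h1 : x = x' := strictMonoOn_circleArea.injOn ⟨hx.1.le, hx.2.le⟩ ⟨hx'.1.le, hx'.2.le⟩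
    ((div_left_inj' Real.pi_ne_zero).1 heq.1)
  subst h1
  have hs := Real.sqrt_pos.2 (one_sub_sq_pos hx)
  have h2 := mul_right_cancel₀ (by positivity) heq.2
  rw [h2]

theorem exists_discToSquare_eq {w : ℝ × ℝ} (hw : w ∈ openSquare) :
    ∃ x y : ℝ, x ^ 2 + y ^ 2 < 1 ∧ discToSquare (x, y) = w := by
  obtain ⟨⟨h1, h2⟩, h3, h4⟩ := hw
  have hpi := Real.pi_pos
  obtain ⟨x, hx, hxe⟩ : (w.1 - 1 / 2) * Real.pi ∈ circleArea '' Set.Ioo (-1) 1 := by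
    apply intermediate_value_Ioo (by norm_num) continuous_circleArea.continuousOn
    rw [circleArea_one, circleArea_neg_one]
    constructor <;> nlinarith
  have hpos := one_sub_sq_pos hx
  have hs := Real.sqrt_pos.2 hpos
  have hsq := Real.sq_sqrt hpos.le
  refine ⟨x, (w.2 - 1 / 2) * (2 * √(1 - x ^ 2)), ?_, ?_⟩
  · have h5 : (w.2 - 1 / 2) ^ 2 < 1 / 4 := by nlinarith
    have h6 : ((w.2 - 1 / 2) * (2 * √(1 - x ^ 2))) ^ 2
        = 4 * (w.2 - 1 / 2) ^ 2 * (1 - x ^ 2) := by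
      rw [mul_pow, mul_pow, hsq]; ring
    rw [h6]
    nlinarith
  · simp only [discToSquare, hxe]
    ext
    · field_simp
      ring
    · simp only
      field_simp
      ring

/-! ### The area-preserving map from the annulus to the square -/

/-- Symplectic polar coordinates. -/
noncomputable def symplecticPolar (w : ℝ × ℝ) : ℝ × ℝ :=
  (√w.1 * Real.cos (2 * Real.pi * w.2), √w.1 * Real.sin (2 * Real.pi * w.2))

theorem symplecticPolar_sq {q : ℝ} (hq : 0 ≤ q) (p : ℝ) :
    (symplecticPolar (q, p)).1 ^ 2 + (symplecticPolar (q, p)).2 ^ 2 = q := by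
  simp only [symplecticPolar, mul_pow, Real.sq_sqrt hq]
  rw [← mul_add, Real.cos_sq_add_sin_sq, mul_one]

theorem contDiffAt_symplecticPolar {w : ℝ × ℝ} (hw : 0 < w.1) :
    ContDiffAt ℝ ∞ symplecticPolar w := by
  have hs : ContDiffAt ℝ ∞ (fun w : ℝ × ℝ => √w.1) w := contDiffAt_fst.sqrt hw.ne'
  unfold symplecticPolar
  refine ContDiffAt.prodMk ?_ ?_
  · exact hs.mul (Real.contDiff_cos.contDiffAt.comp w (by fun_prop))
  · exact hs.mul (Real.contDiff_sin.contDiffAt.comp w (by fun_prop))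

/-- With `r² = q` and `θ = 2πp`, `r dr dθ = π dq dp`; this cancels the factor `1/π` of
`discToSquare`. -/
theorem scalesArea_symplecticPolar {w : ℝ × ℝ} (hw : 0 < w.1) :
    ScalesArea symplecticPolar w Real.pi := by
  have hs := Real.sqrt_pos.2 hw
  have hfst : HasFDerivAt Prod.fst (ContinuousLinearMap.fst ℝ ℝ ℝ) w := hasFDerivAt_fst
  have h1 := (Real.hasDerivAt_sqrt hw.ne').comp_hasFDerivAt w hfst
  have h2 := (hasFDerivAt_snd (𝕜 := ℝ) (p := w)).const_mul (2 * Real.pi)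
  refine ⟨_, (h1.mul h2.cos).prodMk (h1.mul h2.sin), fun u v => ?_⟩
  have hcs := Real.sin_sq_add_cos_sq (2 * Real.pi * w.2)
  simp [areaForm]
  field_simp
  linear_combination (4 * √w.1 ^ 2 * Real.pi * (u.1 * v.2 - u.2 * v.1)) * hcs

/-- An area-preserving embedding of the annulus `(0,1) × ℝ/ℤ` into the unit square. -/
noncomputable def annulusToSquare (w : ℝ × ℝ) : ℝ × ℝ := discToSquare (symplecticPolar w)

theorem symplecticPolar_mem_disc {q : ℝ} (hq : q ∈ Set.Ico (0 : ℝ) 1) (p : ℝ) :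
    (symplecticPolar (q, p)).1 ^ 2 + (symplecticPolar (q, p)).2 ^ 2 < 1 := by
  rw [symplecticPolar_sq hq.1]
  exact hq.2

theorem contDiffAt_annulusToSquare {w : ℝ × ℝ} (hw : w.1 ∈ Set.Ioo (0 : ℝ) 1) :
    ContDiffAt ℝ ∞ annulusToSquare w :=
  (contDiffAt_discToSquare (fst_mem_of_mem_disc
    (symplecticPolar_mem_disc ⟨hw.1.le, hw.2⟩ w.2))).comp w (contDiffAt_symplecticPolar hw.1)

theorem scalesArea_annulusToSquare {w : ℝ × ℝ} (hw : w.1 ∈ Set.Ioo (0 : ℝ) 1) :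
    ScalesArea annulusToSquare w 1 := by
  have h := (scalesArea_discToSquare (fst_mem_of_mem_disc
    (symplecticPolar_mem_disc ⟨hw.1.le, hw.2⟩ w.2))).comp (scalesArea_symplecticPolar hw.1)
  rwa [one_div_mul_cancel Real.pi_ne_zero] at h

theorem annulusToSquare_mem {q : ℝ} (hq : q ∈ Set.Ico (0 : ℝ) 1) (p : ℝ) :
    annulusToSquare (q, p) ∈ openSquare :=
  discToSquare_mem (symplecticPolar_mem_disc hq p)

theorem annulusToSquare_add_intCast (q p : ℝ) (k : ℤ) :
    annulusToSquare (q, p + k) = annulusToSquare (q, p) := by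
  have h : 2 * Real.pi * (p + k) = 2 * Real.pi * p + k * (2 * Real.pi) := by ring
  simp only [annulusToSquare, symplecticPolar, h, Real.cos_add_int_mul_two_pi,
    Real.sin_add_int_mul_two_pi]

/-- The squared radius recovers `q` and the angle recovers `p` modulo 1, except at the centre `q =
0`, where the angle is undetermined. -/
theorem annulusToSquare_eq {q q' p p' : ℝ} (hq : q ∈ Set.Ico (0 : ℝ) 1)
    (hq' : q' ∈ Set.Ico (0 : ℝ) 1) (h : annulusToSquare (q, p) = annulusToSquare (q', p')) :
    q = q' ∧ (q ≠ 0 → ∃ k : ℤ, p = p' + k) := by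
  have hP := discToSquare_injOn (symplecticPolar_mem_disc hq p)
    (symplecticPolar_mem_disc hq' p') h
  have hqq : q = q' := by
    rw [← symplecticPolar_sq hq.1 p, hP, symplecticPolar_sq hq'.1 p']
  subst hqq
  refine ⟨rfl, fun hq0 => ?_⟩
  have hs : √q ≠ 0 := (Real.sqrt_pos.2 (lt_of_le_of_ne hq.1 (Ne.symm hq0))).ne'
  simp only [symplecticPolar, Prod.mk.injEq] at hP
  have hang := Real.Angle.cos_sin_inj (mul_left_cancel₀ hs hP.1) (mul_left_cancel₀ hs hP.2)
  obtain ⟨k, hk⟩ := Real.Angle.angle_eq_iff_two_pi_dvd_sub.1 hang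
  refine ⟨k, ?_⟩
  have : 2 * Real.pi * p = 2 * Real.pi * (p' + k) := by linarith
  exact mul_left_cancel₀ (by positivity) this

theorem exists_annulusToSquare_eq {w : ℝ × ℝ} (hw : w ∈ openSquare) :
    ∃ q ∈ Set.Ico (0 : ℝ) 1, ∃ p, annulusToSquare (q, p) = w := by
  obtain ⟨x, y, hxy, rfl⟩ := exists_discToSquare_eq hw
  let z : ℂ := ⟨x, y⟩
  have hz : √(x ^ 2 + y ^ 2) = ‖z‖ := by
    rw [Complex.norm_def, Complex.normSq_mk]
    ring_nf
  refine ⟨x ^ 2 + y ^ 2, ⟨by positivity, hxy⟩, z.arg / (2 * Real.pi), ?_⟩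
  have h : 2 * Real.pi * (z.arg / (2 * Real.pi)) = z.arg := by
    have := Real.pi_pos
    field_simp
  simp only [annulusToSquare, symplecticPolar, h, hz, Complex.norm_mul_cos_arg,
    Complex.norm_mul_sin_arg]
  rfl

/-- Where `sin a ≠ 0`, the unit circle lands on a horizontal edge. At `(±1, 0)` the second
coordinate is `1/2` because the numerator vanishes, but the first is `1` or `0`. -/
theorem annulusToSquare_one_notMem (p : ℝ) : annulusToSquare (1, p) ∉ openSquare := by
  set a := 2 * Real.pi * p with ha
  have hsc := Real.sin_sq_add_cos_sq a
  rintro ⟨h1, h2⟩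
  simp only [annulusToSquare, symplecticPolar, Real.sqrt_one, one_mul, ← ha, discToSquare] at h1 h2
  have hsin : √(1 - Real.cos a ^ 2) = |Real.sin a| := by
    rw [← Real.sqrt_sq_eq_abs]
    congr 1
    linarith
  rw [hsin] at h2
  rcases eq_or_ne (Real.sin a) 0 with h0 | h0
  · have hc : Real.cos a ^ 2 = 1 := by rw [h0] at hsc; linarith
    have hpi := Real.pi_pos
    rcases sq_eq_one_iff.1 hc with hc | hc <;> rw [hc] at h1
    · rw [circleArea_one] at h1
      have : Real.pi / 2 / Real.pi = 1 / 2 := by field_simp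
      rw [this] at h1
      norm_num at h1
    · rw [circleArea_neg_one] at h1
      have : -(Real.pi / 2) / Real.pi = -(1 / 2) := by field_simp
      rw [this] at h1
      norm_num at h1
  · rcases abs_cases (Real.sin a) with ⟨h, -⟩ | ⟨h, -⟩ <;> rw [h] at h2
    · have : Real.sin a * (2 * Real.sin a)⁻¹ = 1 / 2 := by field_simp
      rw [this] at h2
      norm_num at h2
    · have : Real.sin a * (2 * -Real.sin a)⁻¹ = -(1 / 2) := by field_simp
      rw [this] at h2
      norm_num at h2

/-- The radial arcs extend continuously up to the boundary of the square. -/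
theorem continuousOn_annulusToSquare_radial (p : ℝ) :
    ContinuousOn (fun q => annulusToSquare (q, p)) (Set.Icc 0 1) := by
  set a := 2 * Real.pi * p with ha
  have hsc := Real.sin_sq_add_cos_sq a
  simp only [annulusToSquare, symplecticPolar, ← ha, discToSquare]
  refine ContinuousOn.prodMk ?_ ?_
  · have := continuous_circleArea
    fun_prop
  -- Along a horizontal radius the numerator is identically zero, so the vanishing chord at `q = 1`
  -- does no harm; along any other radius the chord length stays positive.
  · rcases eq_or_ne (Real.sin a) 0 with h0 | h0
    · simp only [h0, mul_zero, zero_mul]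
      fun_prop
    · refine continuousOn_const.add (ContinuousOn.mul (by fun_prop)
        (ContinuousOn.inv₀ (by fun_prop) ?_))
      intro q hq
      have : 0 < Real.sin a ^ 2 := by positivity
      have hpos : 0 < 1 - (√q * Real.cos a) ^ 2 := by
        rw [mul_pow, Real.sq_sqrt hq.1]
        nlinarith [hq.2, hq.1, sq_nonneg (Real.cos a)]
      have := Real.sqrt_pos.2 hpos
      positivity

theorem continuous_annulusToSquare_circle {q : ℝ} (hq : q ∈ Set.Ico (0 : ℝ) 1) :
    Continuous (fun p => annulusToSquare (q, p)) := by
  rw [continuous_iff_continuousAt]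
  intro p
  have h1 : ContinuousAt discToSquare (symplecticPolar (q, p)) :=
    (contDiffAt_discToSquare (fst_mem_of_mem_disc
      (symplecticPolar_mem_disc hq p))).continuousAt
  have h2 : Continuous fun p => symplecticPolar (q, p) := by
    unfold symplecticPolar
    fun_prop
  exact ContinuousAt.comp (f := fun p => symplecticPolar (q, p)) h1 h2.continuousAt

/-! ### Connectedness of the complement of slit annuli -/

theorem mem_openSquare_iff_norm (w : ℝ × ℝ) :
    w ∈ openSquare ↔ ‖w - (1 / 2, 1 / 2)‖ < 1 / 2 := by
  simp only [openSquare, Set.mem_prod, Set.mem_Ioo, Prod.norm_def, max_lt_iff, Prod.fst_sub,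
    Prod.snd_sub, Real.norm_eq_abs, abs_lt]
  constructor
  · rintro ⟨⟨_, _⟩, _, _⟩
    refine ⟨⟨?_, ?_⟩, ?_, ?_⟩ <;> linarith
  · rintro ⟨⟨_, _⟩, _, _⟩
    refine ⟨⟨?_, ?_⟩, ?_, ?_⟩ <;> linarith

/-- In the sup norm the square is a ball, so its complement is the image of sphere × ray, and the
sphere is path-connected in dimension two. -/
theorem isPathConnected_compl_openSquare : IsPathConnected openSquareᶜ := by
  have hrank : 1 < Module.rank ℝ (ℝ × ℝ) := by
    rw [rank_prod', Module.rank_self, one_add_one_eq_two]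
    exact Cardinal.one_lt_two
  have hsph := isPathConnected_sphere hrank 0 (zero_le_one (α := ℝ))
  have hray : IsPathConnected (Set.Ici (1 / 2 : ℝ)) :=
    (convex_Ici _).isPathConnected Set.nonempty_Ici
  have h := (hsph.prod hray).image
    (f := fun v : (ℝ × ℝ) × ℝ => ((1 / 2, 1 / 2) : ℝ × ℝ) + v.2 • v.1)
    (by fun_prop)
  convert h using 1
  ext w
  simp only [Set.mem_compl_iff, mem_openSquare_iff_norm, not_lt, Set.mem_image, Set.mem_prod,
    mem_sphere_zero_iff_norm, Set.mem_Ici, Prod.exists]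
  constructor
  · intro hw
    have h0 : ‖w - (1 / 2, 1 / 2)‖ ≠ 0 := by linarith
    have hex : ∃ u : ℝ × ℝ, ∃ t : ℝ, (‖u‖ = 1 ∧ 1 / 2 ≤ t) ∧ (1 / 2, 1 / 2) + t • u = w := by
      refine ⟨‖w - (1 / 2, 1 / 2)‖⁻¹ • (w - (1 / 2, 1 / 2)), ‖w - (1 / 2, 1 / 2)‖, ⟨?_, hw⟩, ?_⟩
      · rw [norm_smul, norm_inv, norm_norm, inv_mul_cancel₀ h0]
      · rw [smul_inv_smul₀ h0]
        abel
    obtain ⟨⟨a, b⟩, t, h⟩ := hex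
    exact ⟨a, b, t, h⟩
  · rintro ⟨a, b, t, ⟨hu, ht⟩, rfl⟩
    rw [add_sub_cancel_left, norm_smul, hu, mul_one, Real.norm_eq_abs]
    exact ht.trans (le_abs_self t)

/-- The complement in the plane of a union of concentric annuli, all slit along a common ray. -/
theorem isPathConnected_compl_image_annulusToSquare (I : Set ℝ) (b : ℝ) :
    IsPathConnected ((fun w : ℝ × ℝ => annulusToSquare (w.1, w.2 + b)) ''
      ((Set.Ioo 0 1 ∩ I) ×ˢ Set.Ioo 0 1))ᶜ := by
  set S := (fun w : ℝ × ℝ => annulusToSquare (w.1, w.2 + b)) ''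
      ((Set.Ioo 0 1 ∩ I) ×ˢ Set.Ioo 0 1) with hS
  have hout : openSquareᶜ ⊆ Sᶜ := by
    rw [Set.compl_subset_compl]
    rintro _ ⟨⟨q, p⟩, ⟨⟨hq, -⟩, -⟩, rfl⟩
    exact annulusToSquare_mem ⟨hq.1.le, hq.2⟩ _
  -- A point of the slit in `S` would have an integer angle offset `p` in `(0,1)`. The slit runs
  -- from the centre `q = 0` to the boundary `q = 1`.
  have hslit : ∀ q ∈ Set.Icc (0 : ℝ) 1, annulusToSquare (q, b) ∈ Sᶜ := by
    rintro q hq ⟨⟨q', p⟩, ⟨⟨hq', -⟩, hp⟩, heq⟩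
    rcases hq.2.eq_or_lt with rfl | hq1
    · exact annulusToSquare_one_notMem b (heq ▸ annulusToSquare_mem ⟨hq'.1.le, hq'.2⟩ _)
    · obtain ⟨-, hk⟩ := annulusToSquare_eq ⟨hq'.1.le, hq'.2⟩ ⟨hq.1, hq1⟩ heq
      obtain ⟨k, hk⟩ := hk hq'.1.ne'
      have hpk : p = k := by simp only at hk; linarith
      obtain ⟨hp0, hp1⟩ : 0 < p ∧ p < 1 := hp
      rw [hpk] at hp0 hp1
      have h1 : 0 < k := by exact_mod_cast hp0
      have h2 : k < 1 := by exact_mod_cast hp1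
      omega
  have hslitJoin : ∀ q ∈ Set.Icc (0 : ℝ) 1,
      JoinedIn Sᶜ (annulusToSquare (1, b)) (annulusToSquare (q, b)) := by
    intro q hq
    have hpc := ((convex_Icc q 1).isPathConnected ⟨q, le_rfl, hq.2⟩).image'
      ((continuousOn_annulusToSquare_radial b).mono (Set.Icc_subset_Icc_left hq.1))
    refine (hpc.joinedIn _ ⟨1, ⟨hq.2, le_rfl⟩, rfl⟩ _ ⟨q, ⟨le_rfl, hq.2⟩, rfl⟩).mono ?_
    rintro _ ⟨t, ht, rfl⟩
    exact hslit t ⟨hq.1.trans ht.1, ht.2⟩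
  refine ⟨annulusToSquare (1, b), hslit 1 (by simp), fun {w} hw => ?_⟩
  by_cases hsq : w ∈ openSquare
  · obtain ⟨q, hq, p, rfl⟩ := exists_annulusToSquare_eq hsq
    refine (hslitJoin q ⟨hq.1, hq.2.le⟩).trans ?_
    -- On a circle of the family, only the slit point is missing from `S`. Any other circle (or the
    -- centre) avoids `S` entirely and meets the slit.
    by_cases hqI : 0 < q ∧ q ∈ I
    · have hfr : Int.fract (p - b) = 0 := by
        by_contra hne
        refine hw ⟨(q, Int.fract (p - b)), ⟨⟨⟨hqI.1, hq.2⟩, hqI.2⟩,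
          lt_of_le_of_ne (Int.fract_nonneg _) (Ne.symm hne), Int.fract_lt_one _⟩, ?_⟩
        have h1 : p = (Int.fract (p - b) + b) + (⌊p - b⌋ : ℤ) := by
          have := Int.fract_add_floor (p - b)
          linarith
        conv_rhs => rw [h1, annulusToSquare_add_intCast]
      have h1 : p = b + (⌊p - b⌋ : ℤ) := by
        have := Int.fract_add_floor (p - b)
        linarith
      rw [h1, annulusToSquare_add_intCast]
      exact JoinedIn.refl (hslit q ⟨hq.1, hq.2.le⟩)
    · have hpc := (isPathConnected_univ (X := ℝ)).image (continuous_annulusToSquare_circle hq)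
      refine (hpc.joinedIn _ ⟨b, trivial, rfl⟩ _ ⟨p, trivial, rfl⟩).mono ?_
      rintro _ ⟨t, -, rfl⟩ ⟨⟨q', p'⟩, ⟨⟨hq', hqI'⟩, hp⟩, heq⟩
      obtain ⟨hqq, -⟩ := annulusToSquare_eq ⟨hq'.1.le, hq'.2⟩ hq heq
      simp only at hqq hqI' hq'
      exact hqI ⟨hqq ▸ hq'.1, hqq ▸ hqI'⟩
  · exact (isPathConnected_compl_openSquare.joinedIn _ (annulusToSquare_one_notMem b) _ hsq).mono
      hout

/-! ### Symplectic shears and products of planar maps -/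

/-- The linear shear `p_i ↦ p_i + ∑ⱼ A i j qʲ`. -/
noncomputable def momentumShear {n : ℕ} (A : Matrix (Fin n) (Fin n) ℝ) :
    PhaseSpace n →L[ℝ] PhaseSpace n :=
  ContinuousLinearMap.pi fun i =>
    ((ContinuousLinearMap.fst ℝ ℝ ℝ).comp (ContinuousLinearMap.proj i)).prod
      ((ContinuousLinearMap.snd ℝ ℝ ℝ).comp (ContinuousLinearMap.proj i) +
        ∑ j, A i j • (ContinuousLinearMap.fst ℝ ℝ ℝ).comp (ContinuousLinearMap.proj j))

theorem momentumShear_apply {n : ℕ} (A : Matrix (Fin n) (Fin n) ℝ) (w : PhaseSpace n)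
    (i : Fin n) : momentumShear A w i = ((w i).1, (w i).2 + ∑ j, A i j * (w j).1) := by
  simp [momentumShear]

/-- The shear adds to `p` the gradient of `½ qᵀAq`; the cross terms cancel by symmetry of `A`. -/
theorem omega0_momentumShear {n : ℕ} {A : Matrix (Fin n) (Fin n) ℝ} (hA : A.IsSymm)
    (u v : PhaseSpace n) : omega0 (momentumShear A u) (momentumShear A v) = omega0 u v := by
  have h : ∑ i, ∑ j, (u i).1 * (A i j * (v j).1) = ∑ i, ∑ j, (v i).1 * (A i j * (u j).1) := by
    rw [Finset.sum_comm]
    refine Finset.sum_congr rfl fun i _ => Finset.sum_congr rfl fun j _ => ?_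
    rw [hA.apply i j]
    ring
  simp only [omega0, momentumShear_apply, mul_add, add_mul, Finset.sum_mul, Finset.mul_sum,
    Finset.sum_sub_distrib, Finset.sum_add_distrib]
  have h' : ∑ i, ∑ j, A i j * (u j).1 * (v i).1 = ∑ i, ∑ j, (v i).1 * (A i j * (u j).1) :=
    Finset.sum_congr rfl fun i _ => Finset.sum_congr rfl fun j _ => by ring
  rw [h', h]
  ring

/-- The product of planar maps. -/
def planarProduct {n : ℕ} (F : Fin n → ℝ × ℝ → ℝ × ℝ) (w : PhaseSpace n) : PhaseSpace n :=
  fun i => F i (w i)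

theorem omega0_fderiv_planarProduct_comp {n : ℕ} {F : Fin n → ℝ × ℝ → ℝ × ℝ}
    {T : PhaseSpace n →L[ℝ] PhaseSpace n} (hT : ∀ u v, omega0 (T u) (T v) = omega0 u v)
    {x : PhaseSpace n} (hF : ∀ i, ScalesArea (F i) (T x i) 1) (u v : PhaseSpace n) :
    omega0 (fderiv ℝ (fun w => planarProduct F (T w)) x u)
      (fderiv ℝ (fun w => planarProduct F (T w)) x v) = omega0 u v := by
  choose L hL hL1 using hF
  have hd : HasFDerivAt (fun w => planarProduct F (T w))
      (ContinuousLinearMap.pi fun i => (L i).comp ((ContinuousLinearMap.proj i).comp T)) x := by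
    rw [hasFDerivAt_pi]
    intro i
    exact (hL i).comp x ((ContinuousLinearMap.proj (R := ℝ) (φ := fun _ : Fin n => ℝ × ℝ) i).comp
      T).hasFDerivAt
  rw [hd.fderiv, ← hT u v]
  simp [omega0_eq_sum_areaForm, hL1]

/-! ### The embedding of the cube -/

/-- The area-preserving embedding of `(0,1) × ℝ/cℤ` into the rectangle `(0,1) × (0,c)`. -/
noncomputable def annulusToRectangle (c : ℝ) (w : ℝ × ℝ) : ℝ × ℝ :=
  ((annulusToSquare (w.1, w.2 / c)).1, c * (annulusToSquare (w.1, w.2 / c)).2)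

theorem annulusToRectangle_eq_comp (c : ℝ) : annulusToRectangle c =
    (fun w => (w.1, c * w.2)) ∘ annulusToSquare ∘ fun w => (w.1, c⁻¹ * w.2) := by
  funext w
  simp [annulusToRectangle, div_eq_inv_mul]

theorem contDiffAt_annulusToRectangle (c : ℝ) {w : ℝ × ℝ} (hw : w.1 ∈ Set.Ioo (0 : ℝ) 1) :
    ContDiffAt ℝ ∞ (annulusToRectangle c) w := by
  rw [annulusToRectangle_eq_comp]
  refine ContDiffAt.comp w (by fun_prop) (ContDiffAt.comp w ?_ (by fun_prop))
  exact contDiffAt_annulusToSquare hw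

theorem scalesArea_annulusToRectangle {c : ℝ} (hc : c ≠ 0) {w : ℝ × ℝ}
    (hw : w.1 ∈ Set.Ioo (0 : ℝ) 1) : ScalesArea (annulusToRectangle c) w 1 := by
  rw [annulusToRectangle_eq_comp]
  have h := (scalesArea_mul_snd c _).comp ((scalesArea_annulusToSquare
    (w := (w.1, c⁻¹ * w.2)) hw).comp (scalesArea_mul_snd c⁻¹ w))
  rwa [one_mul, mul_inv_cancel₀ hc] at h

theorem annulusToRectangle_eq {c : ℝ} (hc : 0 < c) {q q' p p' : ℝ}
    (hq : q ∈ Set.Ioo (0 : ℝ) 1) (hq' : q' ∈ Set.Ioo (0 : ℝ) 1)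
    (h : annulusToRectangle c (q, p) = annulusToRectangle c (q', p')) :
    q = q' ∧ ∃ k : ℤ, p = p' + c * k := by
  simp only [annulusToRectangle, Prod.mk.injEq, mul_right_inj' hc.ne'] at h
  obtain ⟨h1, h2⟩ := annulusToSquare_eq ⟨hq.1.le, hq.2⟩ ⟨hq'.1.le, hq'.2⟩ (Prod.ext h.1 h.2)
  obtain ⟨k, hk⟩ := h2 hq.1.ne'
  refine ⟨h1, k, ?_⟩
  field_simp at hk
  exact hk

theorem annulusToRectangle_add_mul_intCast {c : ℝ} (hc : c ≠ 0) (q p : ℝ) (k : ℤ) :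
    annulusToRectangle c (q, p + c * k) = annulusToRectangle c (q, p) := by
  have h : (p + c * k) / c = p / c + k := by field_simp
  simp only [annulusToRectangle, h, annulusToSquare_add_intCast]

/-- The coupling matrix of the first and the last coordinate. -/
def endCoupling (m : ℕ) (c : ℝ) : Matrix (Fin (m + 2)) (Fin (m + 2)) ℝ :=
  fun i j => if (i = 0 ∧ j = Fin.last _) ∨ (i = Fin.last _ ∧ j = 0) then c else 0

theorem endCoupling_isSymm (m : ℕ) (c : ℝ) : (endCoupling m c).IsSymm := by
  ext i j
  simp only [Matrix.transpose_apply, endCoupling]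
  congr 1
  apply propext
  tauto

/-- The planar maps applied after the shear. -/
noncomputable def planarFactor (m : ℕ) (c : ℝ) (i : Fin (m + 2)) : ℝ × ℝ → ℝ × ℝ :=
  if i = 0 then annulusToSquare else if i = Fin.last _ then annulusToRectangle c else id

/-- The symplectic embedding of the cube with minimal sections: wind around the annuli in the
first and the last coordinate plane, then embed both annuli into rectangles. -/
noncomputable def windingEmbedding (m : ℕ) (c : ℝ) (w : PhaseSpace (m + 2)) :
    PhaseSpace (m + 2) :=
  planarProduct (planarFactor m c) (momentumShear (endCoupling m c) w)

theorem windingEmbedding_zero (m : ℕ) (c : ℝ) (w : PhaseSpace (m + 2)) :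
    windingEmbedding m c w 0 =
      annulusToSquare ((w 0).1, (w 0).2 + c * (w (Fin.last _)).1) := by
  simp [windingEmbedding, planarProduct, planarFactor, momentumShear_apply, endCoupling]

theorem windingEmbedding_last (m : ℕ) (c : ℝ) (w : PhaseSpace (m + 2)) :
    windingEmbedding m c w (Fin.last _) =
      annulusToRectangle c ((w (Fin.last _)).1, (w (Fin.last _)).2 + c * (w 0).1) := by
  simp [windingEmbedding, planarProduct, planarFactor, momentumShear_apply, endCoupling]

theorem windingEmbedding_of_ne {m : ℕ} (c : ℝ) (w : PhaseSpace (m + 2)) {i : Fin (m + 2)}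
    (h0 : i ≠ 0) (hl : i ≠ Fin.last _) : windingEmbedding m c w i = w i := by
  simp [windingEmbedding, planarProduct, planarFactor, momentumShear_apply, endCoupling, h0, hl]

theorem eq_of_eq_add_mul_intCast {c x y : ℝ} (hc : 1 ≤ c) (hx : x ∈ Set.Ioo (0 : ℝ) 1)
    (hy : y ∈ Set.Ioo (0 : ℝ) 1) {k : ℤ} (h : x = y + c * k) : x = y := by
  have hk : k = 0 := by
    by_contra hk
    rcases lt_or_gt_of_ne hk with hk | hk
    · have : (k : ℝ) ≤ -1 := by exact_mod_cast (by omega : k ≤ -1)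
      nlinarith [hx.1, hy.2]
    · have : (1 : ℝ) ≤ k := by exact_mod_cast (by omega : 1 ≤ k)
      nlinarith [hx.2, hy.1]
  simpa [hk] using h

/-- The image determines both positions, hence the shear terms, leaving `p₀` known modulo 1 and
`p_last` modulo `c`. Both lie in `(0,1)`, and the periods are at least 1. -/
theorem windingEmbedding_injOn (m : ℕ) {c : ℝ} (hc : 1 ≤ c) :
    Set.InjOn (windingEmbedding m c) (cube (m + 2)) := by
  intro w hw w' hw' h
  have h0 := congrFun h 0
  have hl := congrFun h (Fin.last _)
  rw [windingEmbedding_zero, windingEmbedding_zero] at h0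
  rw [windingEmbedding_last, windingEmbedding_last] at hl
  obtain ⟨hq0, hk⟩ := annulusToSquare_eq ⟨(hw 0).1.1.le, (hw 0).1.2⟩
    ⟨(hw' 0).1.1.le, (hw' 0).1.2⟩ h0
  obtain ⟨k, hk⟩ := hk (hw 0).1.1.ne'
  obtain ⟨hql, k', hk'⟩ := annulusToRectangle_eq (by linarith) (hw _).1 (hw' _).1 hl
  have hp0 := eq_of_eq_add_mul_intCast (k := k) le_rfl (hw 0).2 (hw' 0).2
    (by rw [hql] at hk; linarith)
  have hpl := eq_of_eq_add_mul_intCast (k := k') hc (hw (Fin.last _)).2 (hw' (Fin.last _)).2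
    (by rw [hq0] at hk'; linarith)
  funext i
  by_cases hi0 : i = 0
  · subst hi0
    exact Prod.ext hq0 hp0
  by_cases hil : i = Fin.last _
  · subst hil
    exact Prod.ext hql hpl
  have hi := congrFun h i
  rwa [windingEmbedding_of_ne c w hi0 hil, windingEmbedding_of_ne c w' hi0 hil] at hi

theorem isSymplecticEmbeddingOn_windingEmbedding (m : ℕ) {c : ℝ} (hc : 1 ≤ c) :
    IsSymplecticEmbeddingOn (windingEmbedding m c) (cube (m + 2)) := by
  have hfst : ∀ x ∈ cube (m + 2), ∀ i,
      (momentumShear (endCoupling m c) x i).1 ∈ Set.Ioo (0 : ℝ) 1 := fun x hx i => by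
    rw [momentumShear_apply]
    exact (hx i).1
  refine isSymplecticEmbeddingOn_of_injOn (isOpen_cube _) ?_ (windingEmbedding_injOn m hc) ?_
  · intro x hx
    refine ContDiffAt.contDiffWithinAt ?_
    rw [contDiffAt_pi]
    intro i
    have hS : ContDiffAt ℝ ∞ (fun w => momentumShear (endCoupling m c) w i) x :=
      ((ContinuousLinearMap.proj (R := ℝ) (φ := fun _ : Fin (m + 2) => ℝ × ℝ) i).comp
        (momentumShear (endCoupling m c))).contDiff.contDiffAt
    refine ContDiffAt.comp (g := planarFactor m c i) x ?_ hS
    unfold planarFactor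
    split_ifs
    · exact contDiffAt_annulusToSquare (hfst x hx i)
    · exact contDiffAt_annulusToRectangle c (hfst x hx i)
    · exact contDiffAt_id
  · intro x hx
    refine omega0_fderiv_planarProduct_comp (omega0_momentumShear (endCoupling_isSymm m c)) ?_
    intro i
    unfold planarFactor
    split_ifs
    · exact scalesArea_annulusToSquare (hfst x hx i)
    · exact scalesArea_annulusToRectangle (by linarith) (hfst x hx i)
    · exact scalesArea_id _

theorem mapsTo_windingEmbedding (m : ℕ) {c : ℝ} (hc : 0 < c) :
    Set.MapsTo (windingEmbedding m c) (cube (m + 2)) (polydisc (m + 2) c) := by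
  intro w hw i
  by_cases hil : i = Fin.last _
  · subst hil
    rw [windingEmbedding_last]
    obtain ⟨h1, h2⟩ := annulusToSquare_mem ⟨(hw (Fin.last _)).1.1.le, (hw (Fin.last _)).1.2⟩
      (((w (Fin.last _)).2 + c * (w 0).1) / c)
    refine ⟨h1, ?_⟩
    simp only [annulusToRectangle, Fin.val_last, if_true]
    exact ⟨mul_pos hc h2.1, by nlinarith [h2.2]⟩
  have hval : ¬ (i.val + 1 = m + 2) := fun h => hil (Fin.ext (by simpa using h))
  rw [if_neg hval]
  by_cases hi0 : i = 0
  · subst hi0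
    rw [windingEmbedding_zero]
    exact annulusToSquare_mem ⟨(hw 0).1.1.le, (hw 0).1.2⟩ _
  · rw [windingEmbedding_of_ne c w hi0 hil]
    exact hw i

/-! ### The sections -/

/-- The set of positions `t` for which `s - c t` lies in `(0,1)` modulo `c`. -/
def windingPositions (c s : ℝ) : Set ℝ := {t | ∃ k : ℤ, s - c * t + c * k ∈ Set.Ioo (0 : ℝ) 1}

theorem isOpen_windingPositions (c s : ℝ) : IsOpen (windingPositions c s) := by
  have : windingPositions c s = ⋃ k : ℤ, {t | s - c * t + c * k ∈ Set.Ioo (0 : ℝ) 1} := by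
    ext t
    simp [windingPositions]
  rw [this]
  exact isOpen_iUnion fun k => isOpen_Ioo.preimage (by fun_prop)

/-- The map `t ↦ s - ct` carries `(0,1)` once around `ℝ/cℤ`, so an arc of length 1 pulls back to
length `1/c`. -/
theorem volume_windingPositions_le {c : ℝ} (hc : 1 ≤ c) (s : ℝ) :
    volume (Set.Ioo 0 1 ∩ windingPositions c s) ≤ ENNReal.ofReal (1 / c) := by
  have hc0 : 0 < c := by linarith
  have hc1 : 1 / c ≤ 1 := by rw [div_le_one hc0]; exact hc
  set σ := Int.fract (s / c) with hσ
  have hσ0 : 0 ≤ σ := Int.fract_nonneg _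
  have hσ1 : σ < 1 := Int.fract_lt_one _
  have hs : s = c * (σ + ⌊s / c⌋) := by
    rw [hσ, Int.fract_add_floor]
    field_simp
  -- The pullback is `(σ - 1/c, σ)` modulo 1: `l = 0` is the part inside `(0,1)`, and `l = 1` the
  -- part below 0, wrapped around.
  have hsub : Set.Ioo 0 1 ∩ windingPositions c s ⊆
      Set.Ioo (max 0 (σ - 1 / c)) σ ∪ Set.Ioo (σ + 1 - 1 / c) 1 := by
    rintro t ⟨ht, k, hk⟩
    obtain ⟨l, hl⟩ : ∃ l : ℤ, l = ⌊s / c⌋ + k := ⟨_, rfl⟩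
    have hl' : (l : ℝ) = ⌊s / c⌋ + k := by exact_mod_cast hl
    have heq : s - c * t + c * k = c * (σ + l - t) := by
      rw [hl']
      linear_combination hs
    rw [heq] at hk
    have h1 : 0 < σ + l - t := pos_of_mul_pos_right hk.1 hc0.le
    have h2 : σ + l - t < 1 / c := by rw [lt_div_iff₀ hc0]; linarith [hk.2]
    have hl0 : 0 ≤ l := by
      have : (-1 : ℝ) < l := by linarith [ht.1]
      have : -1 < l := by exact_mod_cast this
      omega
    have hl1 : l ≤ 1 := by
      have : (l : ℝ) < 2 := by linarith [ht.2]
      have : l < 2 := by exact_mod_cast this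
      omega
    obtain rfl | rfl : l = 0 ∨ l = 1 := by omega
    · left
      rw [Int.cast_zero] at h1 h2
      exact ⟨max_lt ht.1 (by linarith), by linarith⟩
    · right
      rw [Int.cast_one] at h1 h2
      exact ⟨by linarith, ht.2⟩
  refine (measure_mono hsub).trans ((measure_union_le _ _).trans ?_)
  rw [Real.volume_Ioo, Real.volume_Ioo]
  -- Either the interval wraps, with pieces of lengths `σ` and `1/c - σ`, or the second piece is
  -- empty.
  rcases le_total σ (1 / c) with h | h
  · rw [max_eq_left (by linarith), ← ENNReal.ofReal_add (by linarith) (by linarith)]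
    exact ENNReal.ofReal_le_ofReal (by linarith)
  · rw [max_eq_right (by linarith), ENNReal.ofReal_of_nonpos (p := 1 - (σ + 1 - 1 / c))
      (by linarith), add_zero]
    exact ENNReal.ofReal_le_ofReal (by linarith)

theorem iota_apply_of_ne {m : ℕ} (z : PhaseSpace (m + 1)) (y y' : ℝ × ℝ) {i : Fin (m + 2)}
    (hi : i ≠ 0) : iota (n := m + 2) z y i = iota (n := m + 2) z y' i := by
  have : i.val ≠ 0 := fun h => hi (Fin.ext h)
  simp [iota, this]

theorem iota_apply_zero {m : ℕ} (z : PhaseSpace (m + 1)) (y : ℝ × ℝ) :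
    iota (n := m + 2) z y 0 = y := by
  simp [iota]

/-- One preimage `w₀` of a section point describes the whole section: its `q_last` gives the angular
shift `b`, and its sheared last momentum gives `s`. -/
theorem section_windingEmbedding (m : ℕ) {c : ℝ} (hc : 0 < c) (z : PhaseSpace (m + 1)) :
    iota (n := m + 2) z ⁻¹' (windingEmbedding m c '' cube (m + 2)) = ∅ ∨
    ∃ b s : ℝ, iota (n := m + 2) z ⁻¹' (windingEmbedding m c '' cube (m + 2)) =
      (fun w : ℝ × ℝ => annulusToSquare (w.1, w.2 + b)) ''
        ((Set.Ioo 0 1 ∩ windingPositions c s) ×ˢ Set.Ioo 0 1) := by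
  rcases Set.eq_empty_or_nonempty
    (iota (n := m + 2) z ⁻¹' (windingEmbedding m c '' cube (m + 2))) with hempty | hne
  · exact Or.inl hempty
  right
  obtain ⟨y₀, w₀, hw₀, hy₀⟩ := hne
  have hl0 : Fin.last (m + 1) ≠ 0 := Fin.last_pos.ne'
  refine ⟨c * (w₀ (Fin.last _)).1, (w₀ (Fin.last _)).2 + c * (w₀ 0).1, ?_⟩
  ext y
  constructor
  · rintro ⟨w, hw, hy⟩
    have hlast : windingEmbedding m c w (Fin.last _) = windingEmbedding m c w₀ (Fin.last _) := by
      rw [hy, hy₀, iota_apply_of_ne z y y₀ hl0]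
    rw [windingEmbedding_last, windingEmbedding_last] at hlast
    obtain ⟨hq, k, hk⟩ := annulusToRectangle_eq hc (hw _).1 (hw₀ _).1 hlast
    have hzero := congrFun hy 0
    rw [windingEmbedding_zero, iota_apply_zero, hq] at hzero
    refine ⟨w 0, ⟨⟨(hw 0).1, k, ?_⟩, (hw 0).2⟩, hzero⟩
    have := (hw (Fin.last _)).2
    rwa [show (w₀ (Fin.last _)).2 + c * (w₀ 0).1 - c * (w 0).1 + c * k = (w (Fin.last _)).2 by
      linarith]
  · rintro ⟨⟨q, p⟩, ⟨⟨hq, k, hk⟩, hp⟩, rfl⟩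
    simp only at hq hk hp
    -- Moving `q₀` to `q` is compensated in `p_last` so that the sheared momentum changes only by
    -- `c·k`; `k` is what brings `p_last` back into `(0,1)`.
    refine ⟨Function.update (Function.update w₀ 0 (q, p)) (Fin.last _)
      ((w₀ (Fin.last _)).1, (w₀ (Fin.last _)).2 + c * (w₀ 0).1 - c * q + c * k), ?_, ?_⟩
    · intro i
      by_cases hil : i = Fin.last _
      · subst hil
        rw [Function.update_self]
        exact ⟨(hw₀ _).1, hk⟩
      rw [Function.update_of_ne hil]
      by_cases hi0 : i = 0
      · subst hi0
        rw [Function.update_self]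
        exact ⟨hq, hp⟩
      · rw [Function.update_of_ne hi0]
        exact hw₀ i
    · funext i
      by_cases hil : i = Fin.last _
      · subst hil
        rw [iota_apply_of_ne z _ y₀ hl0, ← hy₀, windingEmbedding_last, windingEmbedding_last,
          Function.update_self, Function.update_of_ne hl0.symm, Function.update_self,
          ← annulusToRectangle_add_mul_intCast hc.ne' _
            ((w₀ (Fin.last _)).2 + c * (w₀ 0).1) k]
        congr 2
        ring
      by_cases hi0 : i = 0
      · subst hi0
        rw [windingEmbedding_zero, iota_apply_zero, Function.update_self,
          Function.update_of_ne hl0.symm, Function.update_self]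
      · rw [windingEmbedding_of_ne c _ hi0 hil, Function.update_of_ne hil,
          Function.update_of_ne hi0, iota_apply_of_ne z _ y₀ hi0, ← hy₀,
          windingEmbedding_of_ne c _ hi0 hil]

theorem volume_section_windingEmbedding_le {m : ℕ} {c : ℝ} (hc : 1 ≤ c)
    (z : PhaseSpace (m + 1)) :
    volume (iota (n := m + 2) z ⁻¹' (windingEmbedding m c '' cube (m + 2))) ≤
      ENNReal.ofReal (1 / c) := by
  rcases section_windingEmbedding m (by linarith) z with h | ⟨b, s, h⟩ <;> rw [h]
  · simp
  refine (ScalesArea.volume_image_le (((isOpen_Ioo.inter (isOpen_windingPositions c s)).prod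
    isOpen_Ioo).measurableSet) ?_).trans ?_
  · rintro w ⟨⟨hw, -⟩, -⟩
    have := (scalesArea_annulusToSquare (w := (w.1, w.2 + b)) hw).comp (scalesArea_add_snd b w)
    rwa [one_mul] at this
  · rw [Measure.volume_eq_prod, Measure.prod_prod, Real.volume_Ioo]
    simpa using volume_windingPositions_le hc s

theorem isPathConnected_compl_section_windingEmbedding {m : ℕ} {c : ℝ} (hc : 0 < c)
    (z : PhaseSpace (m + 1)) :
    IsPathConnected (iota (n := m + 2) z ⁻¹' (windingEmbedding m c '' cube (m + 2)))ᶜ := by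
  rcases section_windingEmbedding m hc z with h | ⟨b, s, h⟩ <;> rw [h]
  · rw [Set.compl_empty]
    exact isPathConnected_univ
  · exact isPathConnected_compl_image_annulusToSquare _ b

theorem theorem1 (n : ℕ) (hn : 2 ≤ n) (c : ℝ) (hc : 1 ≤ c) :
    (∃ φ : PhaseSpace n → PhaseSpace n,
      IsSymplecticEmbeddingOn φ (cube n) ∧
      Set.MapsTo φ (cube n) (polydisc n c) ∧
      ∀ z : PhaseSpace (n - 1),
        MeasureTheory.volume (iota z ⁻¹' (φ '' cube n)) ≤ ENNReal.ofReal (1 / c) ∧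
        IsPathConnected (iota z ⁻¹' (φ '' cube n))ᶜ) ∧
    (∀ φ : PhaseSpace n → PhaseSpace n,
      IsSymplecticEmbeddingOn φ (cube n) →
      Set.MapsTo φ (cube n) (polydisc n c) →
      ∃ z : PhaseSpace (n - 1),
        ENNReal.ofReal (1 / c) ≤ MeasureTheory.volume (iota z ⁻¹' (φ '' cube n))) := by
  have hc0 : 0 < c := by linarith
  refine ⟨?_, fun φ h hmaps => exists_section_volume_ge hn hc0 h hmaps⟩
  obtain ⟨m, rfl⟩ : ∃ m, n = m + 2 := ⟨n - 2, by omega⟩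
  exact ⟨windingEmbedding m c, isSymplecticEmbeddingOn_windingEmbedding m hc,
    mapsTo_windingEmbedding m hc0, fun z => ⟨volume_section_windingEmbedding_le hc z,
      isPathConnected_compl_section_windingEmbedding hc0 z⟩⟩
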